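/- Let $a,b,c,d,e\in\mathbb{R}$ with $b\neq 0$, let $Q(x,y)=ax^2+bxy+cy^2+dx+ey$, and let $\psi:\mathbb{R}^2\to\mathbb{C}$ be smooth and compactly supported. For $\lambda>0$ put $$(\mathbb{T}_\lambda f)(x)=\int_{\mathbb{R}}e^{i\lambda Q(x,y)}\,\psi(x,y)\,f(y)\,dy,\qquad x\in\mathbb{R}.$$ Then there is a constant $C_1>0$, depending only on $Q$ and $\psi$ (in particular independent of $\lambda$, $p$ and $f$), with $|\psi(x,y)|\le C_1$ for all $(x,y)\in\mathbb{R}^2$, such that the following holds. For every $\lambda>0$, every $1\le p\le 2$ with conjugate exponent $p_1\in[2,\infty]$, $\frac1p+\frac1{p_1}=1$, and every complex-valued $f\in L_p(\mathbb{R})$, the integral defining $(\mathbb{T}_\lambda f)(x)$ converges absolutely for every $x\in\mathbb{R}$, $\mathbb{T}_\lambda f\in L_{p_1}(\mathbb{R})$, and $$\|\mathbb{T}_\lambda f\|_{L_{p_1}(\mathbb{R})}\le C_1^{\frac2p-1}\left(\frac{C_1}{\sqrt{\lambda}}\right)^{2\left(1-\frac1p\right)}\|f\|_{L_p(\mathbb{R})}.$$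 -/

import Mathlib

open MeasureTheory
open scoped ENNReal ContDiff

/-- The quadratic phase `Q(x,y) = a x² + b x y + c y² + d x + e y`. -/
def quadPhase (a b c d e x y : ℝ) : ℝ :=
  a * x ^ 2 + b * x * y + c * y ^ 2 + d * x + e * y

/-- The integrand `y ↦ e^{iλQ(x,y)} ψ(x,y) f(y)`, where `lam` is the parameter `λ`. -/
noncomputable def oscIntegrand (a b c d e : ℝ) (ψ : ℝ × ℝ → ℂ) (lam : ℝ) (f : ℝ → ℂ)
    (x y : ℝ) : ℂ :=
  Complex.exp (Complex.I * ((lam * quadPhase a b c d e x y : ℝ) : ℂ)) * ψ (x, y) * f y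

/-- The oscillatory integral operator `(T_λ f)(x) = ∫ e^{iλQ(x,y)} ψ(x,y) f(y) dy`. -/
noncomputable def oscOp (a b c d e : ℝ) (ψ : ℝ × ℝ → ℂ) (lam : ℝ) (f : ℝ → ℂ) (x : ℝ) : ℂ :=
  ∫ y : ℝ, oscIntegrand a b c d e ψ lam f x y

/-!
The total power of `C₁` in the claimed bound is `(2/p - 1) + 2 (1 - 1/p) = 1`, so it suffices to
show `‖T f‖_{p₁} ≤ 2 C λ^{-1/p₁} ‖f‖_p` with a constant `C` independent of `λ`, `p` and `f`; then
`C₁ = 2 C` works. This leaves room for real interpolation, provided that its constant does not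
blow up at either end of the range of `p`.

*The endpoints.* The bound `L¹ → L^∞` is `|T f| ≤ sup |ψ| ‖f‖₁` (`enorm_oscOp_le`). For `L² → L²`,
the factors of the phase that depend on `x` alone or on `y` alone are unimodular, which leaves the
kernel `e^{iκxy} ψ(x,y)` with `κ = λb`. Writing `ψ(x,y) = ∫_{u ≤ x} ∂₁ψ(u,y) du` and applying
Fubini bounds `|T f(x)|` by `∫ |F_u(x)| du`, where `F_u` is a rescaled Fourier transform of
`∂₁ψ(u,·) f` up to a unimodular factor. The `u`-integral extends over a fixed bounded interval, so
the Cauchy-Schwarz inequality in `u` and Plancherel's identity in `x` give the factor `|κ|^{-1}`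
in `∫ |T f|²` (`exists_lintegral_enorm_oscOp_sq_le`).

*Interpolation* (`lintegral_rpow_le_of_truncation`). Write `q = p₁ > 2` and `N = ∫ |f|^p`. For
`s > 0`, split `f` at a height `t(s)` chosen so that `T` maps the part of `f` above `t(s)` to a
function bounded by `s`. Where `|T f| > 2s`, at least half of `|T f|` then comes from the part
below `t(s)`, whence `∫_{|T f| > 2s} |T f|² ≤ 4 B ∫_{|f| ≤ t(s)} |f|²` with `B` the constant of the
`L²` bound. Multiplying by `s^{q-3}` and integrating over `s > 0`, both sides acquire the same
factor `1/(q-2)`, which therefore cancels: the constant stays bounded as `q → 2`. Keeping the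
square of `|T f|` on the left, rather than the measure of `{|T f| > 2s}`, is what makes this
cancellation happen.
-/

/-! ### Plancherel's identity for the Fourier integral -/

open scoped FourierTransform SchwartzMap in
/-- On `L¹ ∩ L²` the Fourier transform that extends the one on Schwartz functions to `L²` is given
by the Fourier integral: both represent the same tempered distribution. -/
lemma lpFourier_ae_eq_fourier_of_integrable {h : ℝ → ℂ} (h1 : Integrable h) (h2 : MemLp h 2) :
    ⇑(𝓕 (h2.toLp h) : Lp ℂ 2 (volume : Measure ℝ)) =ᵐ[volume] 𝓕 h := by
  have hcont : Continuous (𝓕 h) :=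
    VectorFourier.fourierIntegral_continuous Real.continuous_fourierChar
      (by fun_prop) h1
  refine ae_eq_of_integral_contDiff_smul_eq
    ((Lp.memLp _).locallyIntegrable (by norm_num)) hcont.locallyIntegrable ?_
  intro g hg hgc
  have hg₁ : HasCompactSupport (Complex.ofRealCLM ∘ g) := hgc.comp_left rfl
  have hg₂ : ContDiff ℝ ∞ (Complex.ofRealCLM ∘ g) := by fun_prop
  set φ : 𝓢(ℝ, ℂ) := hg₁.toSchwartzMap hg₂
  have hφ : ∀ x, φ x = (g x : ℂ) := fun x => rfl
  have e1 : ∫ x, g x • (𝓕 (h2.toLp h) : Lp ℂ 2 (volume : Measure ℝ)) x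
      = Lp.toTemperedDistribution (𝓕 (h2.toLp h) : Lp ℂ 2 (volume : Measure ℝ)) φ := by
    simp [Lp.toTemperedDistribution_apply, hφ]
  rw [e1, ← Lp.fourier_toTemperedDistribution_eq, TemperedDistribution.fourier_apply,
    Lp.toTemperedDistribution_apply]
  have e2 : ∫ x, (𝓕 φ) x • (h2.toLp h) x = ∫ x, (𝓕 (φ : ℝ → ℂ)) x • h x := by
    refine integral_congr_ae ?_
    filter_upwards [h2.coeFn_toLp] with x hx
    rw [hx]; rfl
  rw [e2]
  -- self-adjointness of the Fourier integral moves it from the test function to `h`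
  have e3 := VectorFourier.integral_fourierIntegral_smul_eq_flip (L := innerₗ ℝ)
    (μ := volume) (ν := volume) (f := (φ : ℝ → ℂ)) (g := h)
    Real.continuous_fourierChar (by fun_prop) φ.integrable h1
  rw [flip_innerₗ] at e3
  refine e3.trans ?_
  refine integral_congr_ae (Filter.Eventually.of_forall fun x => ?_)
  simp only [hφ]
  exact (Complex.real_smul).symm

/-- Plancherel's identity for the Fourier integral on `L¹ ∩ L²`. -/
lemma lintegral_enorm_fourier_sq {h : ℝ → ℂ} (h1 : Integrable h) (h2 : MemLp h 2) :
    ∫⁻ x, ‖FourierTransform.fourier h x‖ₑ ^ 2 = ∫⁻ x, ‖h x‖ₑ ^ 2 := by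
  have key : eLpNorm (FourierTransform.fourier h) 2 volume = eLpNorm h 2 volume := by
    rw [← eLpNorm_congr_ae (lpFourier_ae_eq_fourier_of_integrable h1 h2),
      ← eLpNorm_congr_ae h2.coeFn_toLp, ← Lp.enorm_def, ← Lp.enorm_def,
      enorm_eq_iff_norm_eq, Lp.norm_fourier_eq]
  have e := fun g : ℝ → ℂ => eLpNorm_nnreal_pow_eq_lintegral (f := g) (μ := volume)
    (p := 2) (by norm_num)
  simp only [NNReal.coe_ofNat, ENNReal.rpow_ofNat, ENNReal.coe_ofNat] at e
  rw [← e, ← e, key]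

/-- Plancherel's identity with the phase `e^{iκxy}`, by rescaling `x`. -/
lemma lintegral_enorm_integral_exp_mul_sq {h : ℝ → ℂ} (h1 : Integrable h) (h2 : MemLp h 2)
    {κ : ℝ} (hκ : κ ≠ 0) :
    ∫⁻ x : ℝ, ‖∫ y : ℝ, Complex.exp (Complex.I * ((κ * x * y : ℝ) : ℂ)) * h y‖ₑ ^ 2 =
      ENNReal.ofReal (2 * Real.pi / |κ|) * ∫⁻ y, ‖h y‖ₑ ^ 2 := by
  set a : ℝ := -κ / (2 * Real.pi) with ha
  have ha0 : a ≠ 0 := div_ne_zero (neg_ne_zero.2 hκ) (by positivity)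
  have e1 : ∀ x : ℝ, (∫ y : ℝ, Complex.exp (Complex.I * ((κ * x * y : ℝ) : ℂ)) * h y) =
      FourierTransform.fourier h (a * x) := by
    intro x
    rw [Real.fourier_eq']
    congr 1; ext y
    rw [smul_eq_mul, mul_comm Complex.I]
    congr 4
    simp only [RCLike.inner_apply, conj_trivial, ha]
    field_simp
  have hcont : Continuous (FourierTransform.fourier h) :=
    VectorFourier.fourierIntegral_continuous Real.continuous_fourierChar (by fun_prop) h1
  simp only [e1]
  have e2 := lintegral_map (μ := (volume : Measure ℝ))
    (f := fun z : ℝ => ‖FourierTransform.fourier h z‖ₑ ^ 2) (g := fun x : ℝ => a * x)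
    (by fun_prop) (by fun_prop)
  rw [← e2, Real.map_volume_mul_left ha0, lintegral_smul_measure, lintegral_enorm_fourier_sq h1 h2,
    smul_eq_mul]
  congr 2
  rw [ha, abs_inv, abs_div, abs_neg, abs_of_pos Real.two_pi_pos, inv_div]

/-! ### The bound on `L²` -/

lemma exists_bound_of_continuous_of_hasCompactSupport {φ : ℝ × ℝ → ℂ} (hφ : Continuous φ)
    (hφc : HasCompactSupport φ) :
    ∃ R M : ℝ, 0 < R ∧ 0 < M ∧ (∀ z, ‖φ z‖ ≤ M) ∧
      ∀ x y, φ (x, y) ≠ 0 → x ∈ Set.Icc (-R) R ∧ y ∈ Set.Icc (-R) R := by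
  obtain ⟨M, hM⟩ := hφc.exists_bound_of_continuous hφ
  obtain ⟨R, hR⟩ := hφc.isCompact.isBounded.subset_closedBall 0
  refine ⟨max R 1, max M 1, by positivity, by positivity,
    fun z => (hM z).trans (le_max_left _ _), fun x y hxy => ?_⟩
  have h1 : (x, y) ∈ Metric.closedBall (0 : ℝ × ℝ) R := hR (subset_tsupport _ hxy)
  rw [mem_closedBall_zero_iff, Prod.norm_def, max_le_iff] at h1
  constructor
  · exact abs_le.1 (h1.1.trans (le_max_left _ _))
  · exact abs_le.1 (h1.2.trans (le_max_left _ _))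

lemma integrable_slice_mul {φ : ℝ × ℝ → ℂ} (hφ : Continuous φ) (hφc : HasCompactSupport φ)
    {g : ℝ → ℂ} (hg : LocallyIntegrable g) (x : ℝ) : Integrable fun y => φ (x, y) * g y := by
  obtain ⟨R, M, -, -, -, hR⟩ := exists_bound_of_continuous_of_hasCompactSupport hφ hφc
  refine hg.integrable_smul_left_of_hasCompactSupport (g := fun y => φ (x, y)) (by fun_prop) ?_
  refine HasCompactSupport.intro (isCompact_Icc (a := -R) (b := R)) fun y hy => ?_
  by_contra h
  exact hy (hR x y h).2

/-- The Cauchy-Schwarz inequality against the constant function `1`. -/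
lemma lintegral_sq_le_measure_mul {α : Type*} [MeasurableSpace α] {μ : Measure α} {φ : α → ℝ≥0∞}
    (hφ : AEMeasurable φ μ) : (∫⁻ u, φ u ∂μ) ^ 2 ≤ μ Set.univ * ∫⁻ u, φ u ^ 2 ∂μ := by
  have h := ENNReal.lintegral_mul_le_Lp_mul_Lq μ Real.HolderConjugate.two_two hφ
    (aemeasurable_const (b := (1 : ℝ≥0∞)))
  simp only [Pi.mul_apply, mul_one, lintegral_const, one_pow, one_mul,
    ENNReal.rpow_ofNat] at h
  calc (∫⁻ u, φ u ∂μ) ^ 2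
      ≤ ((∫⁻ u, φ u ^ 2 ∂μ) ^ (1 / 2 : ℝ) * μ Set.univ ^ (1 / 2 : ℝ)) ^ 2 := by gcongr
    _ = _ := by
      rw [mul_pow, ← ENNReal.rpow_mul_natCast, ← ENNReal.rpow_mul_natCast, mul_comm]
      norm_num

/-- The partial derivative of `ψ` in its first variable. -/
noncomputable def partialFst (ψ : ℝ × ℝ → ℂ) (z : ℝ × ℝ) : ℂ := fderiv ℝ ψ z (1, 0)

lemma continuous_partialFst {ψ : ℝ × ℝ → ℂ} (hψ : ContDiff ℝ ∞ ψ) :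
    Continuous (partialFst ψ) :=
  (hψ.continuous_fderiv (by simp)).clm_apply continuous_const

lemma hasCompactSupport_partialFst {ψ : ℝ × ℝ → ℂ} (hψc : HasCompactSupport ψ) :
    HasCompactSupport (partialFst ψ) :=
  hψc.fderiv_apply ℝ (1, 0)

/-- The fundamental theorem of calculus in the first variable: `ψ` vanishes near `-∞`. -/
lemma integral_Iic_partialFst {ψ : ℝ × ℝ → ℂ} (hψ : ContDiff ℝ ∞ ψ) (hψc : HasCompactSupport ψ)
    (x y : ℝ) : ∫ u in Set.Iic x, partialFst ψ (u, y) = ψ (x, y) := by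
  have hd : deriv (fun u => ψ (u, y)) = fun u => partialFst ψ (u, y) := by
    ext u
    have h1 : HasFDerivAt ψ (fderiv ℝ ψ (u, y)) (u, y) :=
      (hψ.differentiable (by simp)).differentiableAt.hasFDerivAt
    have h2 : HasDerivAt (fun u : ℝ => (u, y)) ((1 : ℝ), (0 : ℝ)) u :=
      (hasDerivAt_id u).prodMk (hasDerivAt_const u y)
    exact (h1.comp_hasDerivAt u h2).deriv
  rw [← hd]
  refine HasCompactSupport.integral_Iic_deriv_eq (f := fun u => ψ (u, y))
    ((hψ.of_le (by simp)).comp (by fun_prop)) ?_ x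
  obtain ⟨R, M, -, -, -, hR⟩ := exists_bound_of_continuous_of_hasCompactSupport hψ.continuous hψc
  refine HasCompactSupport.intro (isCompact_Icc (a := -R) (b := R)) fun u hu => ?_
  by_contra h
  exact hu (hR u y h).1

/-- Writing `ψ(x,y) = ∫_{u ≤ x} D(u,y) du` makes the `x`-dependence of the amplitude disappear: by
Fubini, the operator with amplitude `ψ` is dominated by a superposition of operators whose
amplitudes `D(u,·)` do not depend on `x`. -/
lemma enorm_integral_exp_mul_le {D ψ : ℝ × ℝ → ℂ} (hD : Continuous D) {R M : ℝ}
    (hM : ∀ z, ‖D z‖ ≤ M)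
    (hR : ∀ x y, D (x, y) ≠ 0 → x ∈ Set.Icc (-R) R ∧ y ∈ Set.Icc (-R) R)
    (hDψ : ∀ x y, ∫ u in Set.Iic x, D (u, y) = ψ (x, y))
    {g : ℝ → ℂ} (hg : LocallyIntegrable g) (κ x : ℝ) :
    ‖∫ y : ℝ, Complex.exp (Complex.I * ((κ * x * y : ℝ) : ℂ)) * (ψ (x, y) * g y)‖ₑ ≤
      ∫⁻ u in Set.Icc (-R) R,
        ‖∫ y : ℝ, Complex.exp (Complex.I * ((κ * x * y : ℝ) : ℂ)) * (D (u, y) * g y)‖ₑ := by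
  set E : ℝ → ℂ := fun y => Complex.exp (Complex.I * ((κ * x * y : ℝ) : ℂ)) with hE
  have hEn : ∀ y, ‖E y‖ = 1 := fun y => by
    rw [hE]; simp only; rw [mul_comm]; exact Complex.norm_exp_ofReal_mul_I _
  have hEc : Continuous E := by fun_prop
  -- the integrand is dominated by the product of `1_{|y| ≤ R} |g y|` and `1_{|u| ≤ R} M`
  have hint : Integrable (fun z : ℝ × ℝ => E z.1 * (D (z.2, z.1) * g z.1))
      (volume.prod (volume.restrict (Set.Iic x))) := by
    have i1 : Integrable (fun y => (Set.Icc (-R) R).indicator (fun y => ‖g y‖) y) :=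
      (integrable_indicator_iff measurableSet_Icc).2
        (hg.integrableOn_isCompact isCompact_Icc).norm
    have i2 : Integrable (fun u => (Set.Icc (-R) R).indicator (fun _ => M) u)
        (volume.restrict (Set.Iic x)) := by
      refine Integrable.restrict ?_
      exact (integrable_indicator_iff measurableSet_Icc).2
        (continuous_const.integrableOn_Icc)
    refine (i1.mul_prod i2).mono' ?_ (Filter.Eventually.of_forall fun z => ?_)
    · refine (Continuous.aestronglyMeasurable (by fun_prop)).mul
        ((Continuous.aestronglyMeasurable (by fun_prop)).mul ?_)
      exact hg.aestronglyMeasurable.comp_fst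
    · obtain ⟨y, u⟩ := z
      simp only [norm_mul, hEn, one_mul]
      by_cases h0 : D (u, y) = 0
      · rw [h0, norm_zero, zero_mul]
        have : 0 ≤ M := (norm_nonneg _).trans (hM 0)
        exact mul_nonneg (Set.indicator_nonneg (fun _ _ => norm_nonneg _) _)
          (Set.indicator_nonneg (fun _ _ => this) _)
      · obtain ⟨hu, hy⟩ := hR u y h0
        rw [Set.indicator_of_mem hu, Set.indicator_of_mem hy, mul_comm]
        exact mul_le_mul_of_nonneg_left (hM _) (norm_nonneg _)
  have e : ∫ y, E y * (ψ (x, y) * g y) =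
      ∫ u in Set.Iic x, ∫ y, E y * (D (u, y) * g y) := by
    rw [← integral_integral_swap (f := fun y u => E y * (D (u, y) * g y)) hint]
    congr 1; ext y
    rw [integral_const_mul, integral_mul_const, hDψ]
  rw [e]
  refine (enorm_integral_le_lintegral_enorm _).trans ((setLIntegral_le_lintegral _ _).trans ?_)
  rw [← lintegral_indicator measurableSet_Icc]
  refine lintegral_mono fun u => ?_
  by_cases hu : u ∈ Set.Icc (-R) R
  · rw [Set.indicator_of_mem hu]
  · have : ∀ y, D (u, y) = 0 := fun y => by
      by_contra h
      exact hu (hR u y h).1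
    simp [this]

/-- The `L²` bound with decay `|κ|^{-1/2}` for the operator with kernel `e^{iκxy} ψ(x,y)`: the
Cauchy-Schwarz inequality in `u`, then Plancherel's identity in `x` for each fixed `u`. -/
lemma lintegral_enorm_integral_exp_mul_sq_le {D ψ : ℝ × ℝ → ℂ} (hD : Continuous D)
    (hDc : HasCompactSupport D) {R M : ℝ} (hR0 : 0 < R)
    (hM : ∀ z, ‖D z‖ ≤ M)
    (hR : ∀ x y, D (x, y) ≠ 0 → x ∈ Set.Icc (-R) R ∧ y ∈ Set.Icc (-R) R)
    (hDψ : ∀ x y, ∫ u in Set.Iic x, D (u, y) = ψ (x, y))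
    {g : ℝ → ℂ} (hgm : StronglyMeasurable g) (hg : MemLp g 2) {κ : ℝ} (hκ : κ ≠ 0) :
    ∫⁻ x, ‖∫ y : ℝ, Complex.exp (Complex.I * ((κ * x * y : ℝ) : ℂ)) * (ψ (x, y) * g y)‖ₑ ^ 2 ≤
      ENNReal.ofReal ((2 * R * M) ^ 2 * (2 * Real.pi / |κ|)) * ∫⁻ y, ‖g y‖ₑ ^ 2 := by
  have hM0 : 0 ≤ M := (norm_nonneg _).trans (hM 0)
  have hgl : LocallyIntegrable g := hg.locallyIntegrable (by norm_num)
  set Φ : ℝ → ℝ → ℂ := fun x u =>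
    ∫ y : ℝ, Complex.exp (Complex.I * ((κ * x * y : ℝ) : ℂ)) * (D (u, y) * g y) with hΦ
  have hΦm : StronglyMeasurable fun z : ℝ × ℝ => Φ z.1 z.2 := by
    refine StronglyMeasurable.integral_prod_right' (f := fun w : (ℝ × ℝ) × ℝ =>
      Complex.exp (Complex.I * ((κ * w.1.1 * w.2 : ℝ) : ℂ)) * (D (w.1.2, w.2) * g w.2)) ?_
    refine (Continuous.stronglyMeasurable (by fun_prop)).mul
      ((Continuous.stronglyMeasurable (by fun_prop)).mul ?_)
    exact hgm.comp_measurable measurable_snd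
  have hvol : (volume.restrict (Set.Icc (-R) R)) Set.univ = ENNReal.ofReal (2 * R) := by
    rw [Measure.restrict_apply_univ, Real.volume_Icc]; congr 1; ring
  have hslice : ∀ u, ∫⁻ x, ‖Φ x u‖ₑ ^ 2 ≤
      ENNReal.ofReal (2 * Real.pi / |κ|) * (ENNReal.ofReal (M ^ 2) * ∫⁻ y, ‖g y‖ₑ ^ 2) := by
    intro u
    have hm : AEStronglyMeasurable (fun y => D (u, y) * g y) :=
      (Continuous.aestronglyMeasurable (by fun_prop)).mul hgm.aestronglyMeasurable
    have hb : ∀ y, ‖D (u, y) * g y‖ ≤ M * ‖g y‖ := fun y => by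
      rw [norm_mul]; exact mul_le_mul_of_nonneg_right (hM _) (norm_nonneg _)
    rw [hΦ]
    simp only
    rw [lintegral_enorm_integral_exp_mul_sq (integrable_slice_mul hD hDc hgl u)
      (hg.of_le_mul hm (Filter.Eventually.of_forall hb)) hκ]
    gcongr
    rw [← lintegral_const_mul' _ _ ENNReal.ofReal_ne_top]
    refine lintegral_mono fun y => ?_
    rw [ENNReal.ofReal_pow hM0, ← mul_pow, ← ofReal_norm, ← ofReal_norm,
      ← ENNReal.ofReal_mul hM0]
    gcongr
    exact hb y
  calc ∫⁻ x, ‖∫ y : ℝ, Complex.exp (Complex.I * ((κ * x * y : ℝ) : ℂ)) * (ψ (x, y) * g y)‖ₑ ^ 2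
      ≤ ∫⁻ x, ENNReal.ofReal (2 * R) * ∫⁻ u in Set.Icc (-R) R, ‖Φ x u‖ₑ ^ 2 := by
        refine lintegral_mono fun x => ?_
        rw [← hvol]
        refine (pow_le_pow_left₀ zero_le
          (enorm_integral_exp_mul_le hD hM hR hDψ hgl κ x) 2).trans ?_
        refine lintegral_sq_le_measure_mul ?_
        exact (hΦm.comp_measurable measurable_prodMk_left).enorm.aemeasurable
    _ = ENNReal.ofReal (2 * R) * ∫⁻ u in Set.Icc (-R) R, ∫⁻ x, ‖Φ x u‖ₑ ^ 2 := by
        rw [lintegral_const_mul' _ _ ENNReal.ofReal_ne_top, lintegral_lintegral_swap]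
        exact (hΦm.enorm.pow_const 2).aemeasurable
    _ ≤ ENNReal.ofReal (2 * R) * ∫⁻ _ in Set.Icc (-R) R,
        ENNReal.ofReal (2 * Real.pi / |κ|) * (ENNReal.ofReal (M ^ 2) * ∫⁻ y, ‖g y‖ₑ ^ 2) := by
        gcongr; exact hslice _
    _ = _ := by
        rw [lintegral_const, hvol]
        have hR2 : 0 ≤ 2 * R := by positivity
        have hK : 0 ≤ 2 * Real.pi / |κ| := by positivity
        have hM2 : 0 ≤ M ^ 2 := by positivity
        rw [mul_pow]
        generalize 2 * Real.pi / |κ| = K at *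
        generalize 2 * R = P at *
        generalize M ^ 2 = Q at *
        rw [ENNReal.ofReal_mul (by positivity), ENNReal.ofReal_mul (by positivity),
          ENNReal.ofReal_pow hR2]
        ring

/-- The `L²` bound for the oscillatory operator. No integrability of `f` is assumed: when
`∫ |f|² = ∞` the right side is infinite. -/
lemma exists_lintegral_enorm_oscOp_sq_le (a b c d e : ℝ) (hb : b ≠ 0) {ψ : ℝ × ℝ → ℂ}
    (hψ : ContDiff ℝ ∞ ψ) (hψc : HasCompactSupport ψ) :
    ∃ B : ℝ, 0 < B ∧ ∀ lam : ℝ, 0 < lam → ∀ f : ℝ → ℂ, StronglyMeasurable f →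
      ∫⁻ x, ‖oscOp a b c d e ψ lam f x‖ₑ ^ 2 ≤
        ENNReal.ofReal (B ^ 2 / lam) * ∫⁻ y, ‖f y‖ₑ ^ 2 := by
  have hD := continuous_partialFst hψ
  have hDc := hasCompactSupport_partialFst hψc
  obtain ⟨R, M, hR0, hM0, hM, hR⟩ := exists_bound_of_continuous_of_hasCompactSupport hD hDc
  refine ⟨2 * R * M * Real.sqrt (2 * Real.pi / |b|), by positivity, fun lam hlam f hfm => ?_⟩
  by_cases hfin : ∫⁻ y, ‖f y‖ₑ ^ 2 = ⊤
  · rw [hfin, ENNReal.mul_top (ENNReal.ofReal_pos.2 (by positivity)).ne']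
    exact le_top
  have hf : MemLp f 2 := by
    refine ⟨hfm.aestronglyMeasurable, ?_⟩
    rw [eLpNorm_lt_top_iff_lintegral_rpow_enorm_lt_top (by norm_num) (by norm_num)]
    simpa using lt_top_iff_ne_top.2 hfin
  -- absorb the unimodular factor of the phase that depends on `y` alone into `f`
  set g : ℝ → ℂ := fun y =>
    Complex.exp (((lam * (c * y ^ 2 + e * y) : ℝ) : ℂ) * Complex.I) * f y with hg
  have hgn : ∀ y, ‖g y‖ = ‖f y‖ := fun y => by
    rw [hg]; simp only; rw [norm_mul, Complex.norm_exp_ofReal_mul_I, one_mul]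
  have hgm : StronglyMeasurable g := (Continuous.stronglyMeasurable (by fun_prop)).mul hfm
  have hg2 : MemLp g 2 := hf.congr_norm hgm.aestronglyMeasurable
    (Filter.Eventually.of_forall fun y => (hgn y).symm)
  have key := lintegral_enorm_integral_exp_mul_sq_le hD hDc hR0 hM hR
    (integral_Iic_partialFst hψ hψc) hgm hg2 (mul_ne_zero hlam.ne' hb)
  have e1 : ∀ x, ‖oscOp a b c d e ψ lam f x‖ₑ =
      ‖∫ y : ℝ, Complex.exp (Complex.I * ((lam * b * x * y : ℝ) : ℂ)) * (ψ (x, y) * g y)‖ₑ := by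
    intro x
    have : oscOp a b c d e ψ lam f x =
        Complex.exp (((lam * (a * x ^ 2 + d * x) : ℝ) : ℂ) * Complex.I) *
        ∫ y : ℝ, Complex.exp (Complex.I * ((lam * b * x * y : ℝ) : ℂ)) * (ψ (x, y) * g y) := by
      rw [← integral_const_mul]
      refine integral_congr_ae (Filter.Eventually.of_forall fun y => ?_)
      simp only [oscIntegrand, hg, quadPhase]
      have h3 : ∀ A B C z w : ℂ, Complex.exp A * (Complex.exp B * (z * (Complex.exp C * w))) =
          Complex.exp (A + B + C) * z * w := fun A B C z w => by
        rw [Complex.exp_add, Complex.exp_add]; ring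
      rw [h3]
      congr 3
      push_cast
      ring
    rw [this, enorm_mul, ← ofReal_norm, Complex.norm_exp_ofReal_mul_I]
    simp
  have e2 : ∀ y, ‖g y‖ₑ = ‖f y‖ₑ := fun y => by
    rw [← ofReal_norm, ← ofReal_norm, hgn]
  simp only [e1]
  simp only [e2] at key
  refine key.trans_eq ?_
  congr 2
  rw [mul_pow (2 * R * M), Real.sq_sqrt (by positivity), abs_mul, abs_of_pos hlam]
  field_simp

/-! ### Real interpolation by truncation -/

lemma lintegral_Ioo_rpow {r a : ℝ} (hr : -1 < r) (ha : 0 ≤ a) :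
    ∫⁻ s in Set.Ioo 0 a, ENNReal.ofReal (s ^ r) = ENNReal.ofReal (a ^ (r + 1) / (r + 1)) := by
  have hi : IntervalIntegrable (fun s : ℝ => s ^ r) volume 0 a :=
    intervalIntegral.intervalIntegrable_rpow' hr
  rw [← ofReal_integral_eq_lintegral_ofReal, ← integral_Ioc_eq_integral_Ioo,
    ← intervalIntegral.integral_of_le ha, integral_rpow (Or.inl hr),
    Real.zero_rpow (by linarith), sub_zero]
  · exact (intervalIntegrable_iff_integrableOn_Ioo_of_le ha).1 hi
  · filter_upwards [ae_restrict_mem measurableSet_Ioo] with s hs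
    exact Real.rpow_nonneg hs.1.le _

/-- Real interpolation between `L¹ → L^∞` (constant `A`) and `L² → L²` (constant `B` for the
squares), with a constant that stays bounded as `q → 2`. The function `G` stands for `|T f|` and `F`
for `|f|`; the hypothesis `h` records what the endpoint bounds give when `f` is split at height `t`,
with `H` the modulus of the image of the part below `t`. -/
lemma lintegral_rpow_le_of_truncation {α β : Type*} [MeasurableSpace α] [MeasurableSpace β]
    {μ : Measure α} {ν : Measure β} [SFinite μ] [SFinite ν] {F : α → ℝ} {G : β → ℝ}
    (hF : Measurable F) (hG : Measurable G) (hF0 : ∀ y, 0 ≤ F y) (hG0 : ∀ x, 0 ≤ G x)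
    {p q A N : ℝ} {B : ℝ≥0∞} (hpq : p.HolderConjugate q) (hq : 2 < q) (hA : 0 < A) (hN : 0 < N)
    (hFN : ∫⁻ y, ENNReal.ofReal (F y ^ p) ∂μ ≤ ENNReal.ofReal N)
    (h : ∀ t : ℝ, 0 < t → ∃ H : β → ℝ≥0∞,
      (∀ x, ENNReal.ofReal (G x) ≤
        ENNReal.ofReal A * ∫⁻ y in {y | t < F y}, ENNReal.ofReal (F y) ∂μ + H x) ∧
      ∫⁻ x, H x ^ 2 ∂ν ≤ B * ∫⁻ y in {y | F y ≤ t}, ENNReal.ofReal (F y ^ 2) ∂μ) :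
    ∫⁻ x, ENNReal.ofReal (G x ^ q) ∂ν ≤
      ENNReal.ofReal (2 ^ q * A ^ (q - 2) * N ^ (q - 1)) * B := by
  have hp1 : 1 < p := hpq.lt
  have hpq1 : (q - 1) * (p - 1) = 1 := by
    have := hpq.mul_eq_add; linarith
  have hw : Measurable fun s : ℝ => ENNReal.ofReal (s ^ (q - 3)) := by fun_prop
  have hFr : ∀ r : ℝ, Measurable fun y => F y ^ r := fun r => hF.pow_const r
  have hFp : Measurable fun y => ENNReal.ofReal (F y ^ p) := (hFr p).ennreal_ofReal
  -- where `G > 2s`, at least half of `G` comes from the part of `F` below the height `t(s)`;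
  -- the set on the right is `{0 < F ≤ t(s)}`, with the inequality solved for `s`
  have slice : ∀ s : ℝ, 0 < s →
      ∫⁻ x in {x | s < G x / 2}, ENNReal.ofReal (G x ^ 2) ∂ν ≤
        4 * B * ∫⁻ y in {y | F y ≠ 0 ∧ s ≤ A * N * F y ^ (-(p - 1))},
          ENNReal.ofReal (F y ^ 2) ∂μ := by
    intro s hs
    have hAN : 0 < A * N / s := by positivity
    -- with this height the part of `F` above `t` contributes at most `A t ^ (1 - p) N = s`
    set t : ℝ := (A * N / s) ^ (q - 1) with ht
    have ht0 : 0 < t := by positivity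
    have htp : t ^ (-(p - 1)) = s / (A * N) := by
      rw [ht, ← Real.rpow_mul hAN.le, mul_neg, hpq1, Real.rpow_neg_one, inv_div]
    obtain ⟨H, hH1, hH2⟩ := h t ht0
    have hlarge : ENNReal.ofReal A * ∫⁻ y in {y | t < F y}, ENNReal.ofReal (F y) ∂μ ≤
        ENNReal.ofReal s := by
      calc ENNReal.ofReal A * ∫⁻ y in {y | t < F y}, ENNReal.ofReal (F y) ∂μ
          ≤ ENNReal.ofReal A * ∫⁻ y in {y | t < F y},
              ENNReal.ofReal (t ^ (-(p - 1))) * ENNReal.ofReal (F y ^ p) ∂μ := by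
            refine mul_le_mul_right ?_ _
            refine setLIntegral_mono (hFp.const_mul _) fun y hy => ?_
            have hy' : t < F y := hy
            have hFy : 0 < F y := ht0.trans hy'
            rw [← ENNReal.ofReal_mul (by positivity)]
            refine ENNReal.ofReal_le_ofReal ?_
            calc F y = F y ^ (-(p - 1)) * F y ^ p := by
                  rw [← Real.rpow_add hFy]; ring_nf; simp
              _ ≤ t ^ (-(p - 1)) * F y ^ p := by
                  refine mul_le_mul_of_nonneg_right ?_ (by positivity)
                  exact Real.rpow_le_rpow_of_nonpos ht0 hy'.le (by linarith)
        _ ≤ ENNReal.ofReal A * (ENNReal.ofReal (t ^ (-(p - 1))) * ENNReal.ofReal N) := by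
            rw [lintegral_const_mul _ hFp]
            gcongr
            exact (setLIntegral_le_lintegral _ _).trans hFN
        _ = ENNReal.ofReal s := by
            rw [htp, ← ENNReal.ofReal_mul (by positivity), ← ENNReal.ofReal_mul hA.le]
            congr 1; field_simp
    have hset : ∫⁻ y in {y | F y ≤ t}, ENNReal.ofReal (F y ^ 2) ∂μ ≤
        ∫⁻ y in {y | F y ≠ 0 ∧ s ≤ A * N * F y ^ (-(p - 1))}, ENNReal.ofReal (F y ^ 2) ∂μ := by
      have m1 : MeasurableSet {y | F y ≤ t} := measurableSet_le hF measurable_const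
      have m2 : MeasurableSet {y | F y ≠ 0 ∧ s ≤ A * N * F y ^ (-(p - 1))} :=
        (hF (measurableSet_singleton 0)).compl.inter
          (measurableSet_le measurable_const ((hFr _).const_mul _))
      rw [← lintegral_indicator m1, ← lintegral_indicator m2]
      refine lintegral_mono fun y => ?_
      by_cases hy0 : F y = 0
      · simp [Set.indicator, hy0]
      by_cases hyt : F y ≤ t
      · have hFy : 0 < F y := lt_of_le_of_ne (hF0 y) (Ne.symm hy0)
        have : s ≤ A * N * F y ^ (-(p - 1)) := by
          have h1 : t ^ (-(p - 1)) ≤ F y ^ (-(p - 1)) :=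
            Real.rpow_le_rpow_of_nonpos hFy hyt (by linarith)
          rw [htp, div_le_iff₀ (by positivity)] at h1
          linarith
        rw [Set.indicator_of_mem (show y ∈ {y | F y ≤ t} from hyt),
          Set.indicator_of_mem (show y ∈ {y | F y ≠ 0 ∧ s ≤ A * N * F y ^ (-(p - 1))} from
            ⟨hy0, this⟩)]
      · rw [Set.indicator_of_notMem (show y ∉ {y | F y ≤ t} from hyt)]
        exact zero_le
    calc ∫⁻ x in {x | s < G x / 2}, ENNReal.ofReal (G x ^ 2) ∂ν
        ≤ ∫⁻ x in {x | s < G x / 2}, 4 * H x ^ 2 ∂ν := by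
          refine setLIntegral_mono_ae' (measurableSet_lt measurable_const
            (hG.div_const 2)) (Filter.Eventually.of_forall fun x hx => ?_)
          have hx' : s < G x / 2 := hx
          have h1 : ENNReal.ofReal (G x / 2) ≤ H x := by
            have h2 : ENNReal.ofReal (G x / 2) + ENNReal.ofReal (G x / 2) ≤
                ENNReal.ofReal (G x / 2) + H x := by
              rw [← ENNReal.ofReal_add (by linarith) (by linarith), add_halves]
              refine (hH1 x).trans ?_
              gcongr
              exact hlarge.trans (ENNReal.ofReal_le_ofReal hx'.le)
            exact (ENNReal.add_le_add_iff_left ENNReal.ofReal_ne_top).1 h2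
          calc ENNReal.ofReal (G x ^ 2) = 4 * ENNReal.ofReal (G x / 2) ^ 2 := by
                rw [← ENNReal.ofReal_pow (by linarith), ← ENNReal.ofReal_ofNat 4,
                  ← ENNReal.ofReal_mul (by norm_num)]
                congr 1; ring
            _ ≤ 4 * H x ^ 2 := by gcongr
      _ ≤ ∫⁻ x, 4 * H x ^ 2 ∂ν := setLIntegral_le_lintegral _ _
      _ = 4 * ∫⁻ x, H x ^ 2 ∂ν := lintegral_const_mul' _ _ (by norm_num)
      _ ≤ 4 * (B * ∫⁻ y in {y | F y ≠ 0 ∧ s ≤ A * N * F y ^ (-(p - 1))},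
          ENNReal.ofReal (F y ^ 2) ∂μ) := by
          gcongr
          exact hH2.trans (by gcongr)
      _ = _ := by rw [mul_assoc]
  set S : Set (β × ℝ) := {z | z.2 < G z.1 / 2}
  set T : Set (α × ℝ) := {z | F z.1 ≠ 0 ∧ z.2 ≤ A * N * F z.1 ^ (-(p - 1))}
  have mS : MeasurableSet S :=
    measurableSet_lt measurable_snd ((hG.comp measurable_fst).div_const 2)
  have mT : MeasurableSet T :=
    ((hF.comp measurable_fst) (measurableSet_singleton 0)).compl.inter
      (measurableSet_le measurable_snd (((hFr _).comp measurable_fst).const_mul _))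
  -- multiply the slices by `s ^ (q - 3)`, integrate over `s > 0` and exchange integrals on both sides
  have key := calc
    ∫⁻ x, (∫⁻ s in Set.Ioi 0, S.indicator
        (fun z => ENNReal.ofReal (z.2 ^ (q - 3)) * ENNReal.ofReal (G z.1 ^ 2)) (x, s)) ∂ν
      = ∫⁻ s in Set.Ioi 0, ∫⁻ x, S.indicator
        (fun z => ENNReal.ofReal (z.2 ^ (q - 3)) * ENNReal.ofReal (G z.1 ^ 2)) (x, s) ∂ν := by
        refine lintegral_lintegral_swap (Measurable.aemeasurable ?_)
        exact ((hw.comp measurable_snd).mul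
          ((hG.comp measurable_fst).pow_const 2).ennreal_ofReal).indicator mS
    _ = ∫⁻ s in Set.Ioi 0, ENNReal.ofReal (s ^ (q - 3)) *
          ∫⁻ x in {x | s < G x / 2}, ENNReal.ofReal (G x ^ 2) ∂ν := by
        refine lintegral_congr fun s => ?_
        rw [← lintegral_const_mul _ (by fun_prop), ← lintegral_indicator
          (measurableSet_lt measurable_const (hG.div_const 2))]
        rfl
    _ ≤ ∫⁻ s in Set.Ioi 0, ENNReal.ofReal (s ^ (q - 3)) *
          (4 * B * ∫⁻ y in {y | F y ≠ 0 ∧ s ≤ A * N * F y ^ (-(p - 1))},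
          ENNReal.ofReal (F y ^ 2) ∂μ) := by
        refine setLIntegral_mono_ae' measurableSet_Ioi (Filter.Eventually.of_forall fun s hs => ?_)
        gcongr
        exact slice s hs
    _ = ∫⁻ s in Set.Ioi 0, 4 * B * ∫⁻ y, T.indicator
        (fun z => ENNReal.ofReal (z.2 ^ (q - 3)) * ENNReal.ofReal (F z.1 ^ 2)) (y, s) ∂μ := by
        refine lintegral_congr fun s => ?_
        rw [mul_left_comm, ← lintegral_const_mul _ (by fun_prop), ← lintegral_indicator
          (show MeasurableSet {y | F y ≠ 0 ∧ s ≤ A * N * F y ^ (-(p - 1))} from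
            (hF (measurableSet_singleton 0)).compl.inter
              (measurableSet_le measurable_const ((hFr _).const_mul _)))]
        rfl
    _ = 4 * B * ∫⁻ y, (∫⁻ s in Set.Ioi 0, T.indicator
        (fun z => ENNReal.ofReal (z.2 ^ (q - 3)) * ENNReal.ofReal (F z.1 ^ 2)) (y, s)) ∂μ := by
        have mm : Measurable (T.indicator
          (fun z => ENNReal.ofReal (z.2 ^ (q - 3)) * ENNReal.ofReal (F z.1 ^ 2))) :=
          ((hw.comp measurable_snd).mul
          ((hF.comp measurable_fst).pow_const 2).ennreal_ofReal).indicator mT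
        rw [lintegral_const_mul _ (mm.lintegral_prod_left'), lintegral_lintegral_swap]
        exact (mm.comp measurable_swap).aemeasurable
  have left : ∀ x, ENNReal.ofReal (G x ^ q) = ENNReal.ofReal (2 ^ (q - 2) * (q - 2)) *
      ∫⁻ s in Set.Ioi 0, S.indicator
        (fun z => ENNReal.ofReal (z.2 ^ (q - 3)) * ENNReal.ofReal (G z.1 ^ 2)) (x, s) := by
    intro x
    have e : ∫⁻ s in Set.Ioi 0, S.indicator
        (fun z => ENNReal.ofReal (z.2 ^ (q - 3)) * ENNReal.ofReal (G z.1 ^ 2)) (x, s) =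
        ∫⁻ s in Set.Ioo 0 (G x / 2), ENNReal.ofReal (s ^ (q - 3)) * ENNReal.ofReal (G x ^ 2) := by
      rw [← Set.Ioi_inter_Iio, Set.inter_comm, ← Measure.restrict_restrict measurableSet_Iio,
        ← lintegral_indicator measurableSet_Iio]
      rfl
    rw [e, lintegral_mul_const _ hw, lintegral_Ioo_rpow (by linarith) (by linarith [hG0 x]),
      ← ENNReal.ofReal_mul (by have := hG0 x; have : 0 < q - 3 + 1 := by linarith
                               positivity),
      ← ENNReal.ofReal_mul (by have : 0 < q - 2 := by linarith
                               positivity)]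
    congr 1
    rw [Real.div_rpow (hG0 x) (by norm_num), show q - 3 + 1 = q - 2 by ring]
    have h2 : G x ^ (q - 2) * G x ^ 2 = G x ^ q := by
      rw [← Real.rpow_natCast, ← Real.rpow_add_of_nonneg (hG0 x) (by linarith) (by norm_num)]
      norm_num
    have : q - 2 ≠ 0 := by linarith
    rw [← h2]
    field_simp
  have right : ∀ y, ∫⁻ s in Set.Ioi 0, T.indicator
        (fun z => ENNReal.ofReal (z.2 ^ (q - 3)) * ENNReal.ofReal (F z.1 ^ 2)) (y, s) ≤
      ENNReal.ofReal ((A * N) ^ (q - 2) / (q - 2)) * ENNReal.ofReal (F y ^ p) := by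
    intro y
    by_cases hy0 : F y = 0
    · have : ∀ s, T.indicator (fun z => ENNReal.ofReal (z.2 ^ (q - 3)) *
          ENNReal.ofReal (F z.1 ^ 2)) (y, s) = 0 := fun s =>
        Set.indicator_of_notMem (fun hm => hm.1 hy0) _
      simp [this]
    have hFy : 0 < F y := lt_of_le_of_ne (hF0 y) (Ne.symm hy0)
    set R := A * N * F y ^ (-(p - 1)) with hR
    have hR0 : 0 < R := by positivity
    have e : ∫⁻ s in Set.Ioi 0, T.indicator
        (fun z => ENNReal.ofReal (z.2 ^ (q - 3)) * ENNReal.ofReal (F z.1 ^ 2)) (y, s) =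
        ∫⁻ s in Set.Ioo 0 R, ENNReal.ofReal (s ^ (q - 3)) * ENNReal.ofReal (F y ^ 2) := by
      rw [restrict_Ioo_eq_restrict_Ioc, ← Set.Ioi_inter_Iic, Set.inter_comm,
        ← Measure.restrict_restrict measurableSet_Iic, ← lintegral_indicator measurableSet_Iic]
      refine lintegral_congr fun s => ?_
      by_cases hs : s ≤ R
      · rw [Set.indicator_of_mem (show (y, s) ∈ T from ⟨hy0, hs⟩),
          Set.indicator_of_mem (show s ∈ Set.Iic R from hs)]
      · rw [Set.indicator_of_notMem (fun hm : (y, s) ∈ T => hs hm.2),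
          Set.indicator_of_notMem (show s ∉ Set.Iic R from hs)]
    have hq2 : 0 < q - 2 := by linarith
    rw [e, lintegral_mul_const _ hw, lintegral_Ioo_rpow (by linarith) hR0.le,
      show q - 3 + 1 = q - 2 by ring, ← ENNReal.ofReal_mul (by positivity),
      ← ENNReal.ofReal_mul (by positivity), hR,
      Real.mul_rpow (by positivity) (by positivity), ← Real.rpow_mul hFy.le]
    refine le_of_eq ?_
    -- the exponents match because `(p - 1) (q - 2) = 2 - p`
    have h2 : F y ^ (-(p - 1) * (q - 2)) * F y ^ 2 = F y ^ p := by
      rw [← Real.rpow_natCast, ← Real.rpow_add hFy]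
      congr 1
      push_cast
      linear_combination -hpq1
    rw [← h2]
    congr 1
    ring
  have hq2 : 0 < q - 2 := by linarith
  calc ∫⁻ x, ENNReal.ofReal (G x ^ q) ∂ν
      = ENNReal.ofReal (2 ^ (q - 2) * (q - 2)) * ∫⁻ x, (∫⁻ s in Set.Ioi 0, S.indicator
        (fun z => ENNReal.ofReal (z.2 ^ (q - 3)) * ENNReal.ofReal (G z.1 ^ 2)) (x, s)) ∂ν := by
        rw [← lintegral_const_mul' _ _ ENNReal.ofReal_ne_top]
        exact lintegral_congr left
    _ ≤ ENNReal.ofReal (2 ^ (q - 2) * (q - 2)) * (4 * B *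
        ∫⁻ y, ENNReal.ofReal ((A * N) ^ (q - 2) / (q - 2)) * ENNReal.ofReal (F y ^ p) ∂μ) := by
        gcongr
        exact key.trans (by gcongr; exact right _)
    _ ≤ ENNReal.ofReal (2 ^ (q - 2) * (q - 2)) * (4 * B *
        (ENNReal.ofReal ((A * N) ^ (q - 2) / (q - 2)) * ENNReal.ofReal N)) := by
        rw [lintegral_const_mul _ hFp]
        gcongr
    _ = (ENNReal.ofReal (2 ^ (q - 2) * (q - 2)) * ENNReal.ofReal 4 *
        ENNReal.ofReal ((A * N) ^ (q - 2) / (q - 2)) * ENNReal.ofReal N) * B := by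
        rw [ENNReal.ofReal_ofNat]; ring
    _ = _ := by
        rw [← ENNReal.ofReal_mul (by positivity), ← ENNReal.ofReal_mul (by positivity),
          ← ENNReal.ofReal_mul (by positivity), Real.mul_rpow hA.le hN.le]
        congr 2
        have h2 : (2 : ℝ) ^ q = 2 ^ (q - 2) * 4 := by
          rw [show q = (q - 2) + 2 by ring, Real.rpow_add (by norm_num)]
          norm_num
        have h3 : N ^ (q - 1) = N ^ (q - 2) * N := by
          rw [show q - 1 = (q - 2) + 1 by ring, Real.rpow_add hN, Real.rpow_one]
        rw [h2, h3]
        field_simp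

/-! ### The oscillatory operator on `Lᵖ` -/

lemma norm_oscIntegrand (a b c d e : ℝ) (ψ : ℝ × ℝ → ℂ) (lam : ℝ) (f : ℝ → ℂ) (x y : ℝ) :
    ‖oscIntegrand a b c d e ψ lam f x y‖ = ‖ψ (x, y)‖ * ‖f y‖ := by
  rw [oscIntegrand, norm_mul, norm_mul, mul_comm Complex.I, Complex.norm_exp_ofReal_mul_I, one_mul]

lemma integrable_oscIntegrand (a b c d e : ℝ) {ψ : ℝ × ℝ → ℂ} (hψ : Continuous ψ)
    (hψc : HasCompactSupport ψ) (lam : ℝ) {f : ℝ → ℂ} (hf : LocallyIntegrable f) (x : ℝ) :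
    Integrable (oscIntegrand a b c d e ψ lam f x) := by
  refine (integrable_slice_mul hψ hψc hf x).mono ?_ (Filter.Eventually.of_forall fun y => ?_)
  · refine (Continuous.aestronglyMeasurable ?_).mul hf.aestronglyMeasurable
    simp only [quadPhase]
    fun_prop
  · rw [norm_oscIntegrand, norm_mul]

lemma stronglyMeasurable_oscOp (a b c d e : ℝ) {ψ : ℝ × ℝ → ℂ} (hψ : Continuous ψ)
    (lam : ℝ) {f : ℝ → ℂ} (hf : StronglyMeasurable f) :
    StronglyMeasurable (oscOp a b c d e ψ lam f) := by
  refine StronglyMeasurable.integral_prod_right'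
    (f := fun z : ℝ × ℝ => oscIntegrand a b c d e ψ lam f z.1 z.2) ?_
  refine (Continuous.stronglyMeasurable ?_).mul (hf.comp_measurable measurable_snd)
  simp only [quadPhase]
  fun_prop

/-- The `L¹ → L^∞` bound. -/
lemma enorm_oscOp_le (a b c d e : ℝ) {ψ : ℝ × ℝ → ℂ} {A : ℝ} (hA : ∀ z, ‖ψ z‖ ≤ A)
    (lam : ℝ) (f : ℝ → ℂ) (x : ℝ) :
    ‖oscOp a b c d e ψ lam f x‖ₑ ≤ ENNReal.ofReal A * ∫⁻ y, ‖f y‖ₑ := by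
  refine (enorm_integral_le_lintegral_enorm _).trans ?_
  rw [← lintegral_const_mul' _ _ ENNReal.ofReal_ne_top]
  refine lintegral_mono fun y => ?_
  rw [← ofReal_norm, norm_oscIntegrand, ENNReal.ofReal_mul (norm_nonneg _), ofReal_norm (f y)]
  gcongr
  exact hA _

lemma oscOp_congr_ae (a b c d e : ℝ) (ψ : ℝ × ℝ → ℂ) (lam : ℝ) {f g : ℝ → ℂ}
    (hfg : f =ᵐ[volume] g) : oscOp a b c d e ψ lam f = oscOp a b c d e ψ lam g := by
  ext x
  refine integral_congr_ae ?_
  filter_upwards [hfg] with y hy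
  rw [oscIntegrand, oscIntegrand, hy]

lemma oscOp_eq_add_indicator (a b c d e : ℝ) {ψ : ℝ × ℝ → ℂ} (hψ : Continuous ψ)
    (hψc : HasCompactSupport ψ) (lam : ℝ) {f : ℝ → ℂ} (hf : LocallyIntegrable f) {s : Set ℝ}
    (hs : MeasurableSet s) (x : ℝ) :
    oscOp a b c d e ψ lam f x =
      oscOp a b c d e ψ lam (s.indicator f) x + oscOp a b c d e ψ lam (sᶜ.indicator f) x := by
  rw [oscOp, oscOp, oscOp, ← integral_add
    (integrable_oscIntegrand a b c d e hψ hψc lam (hf.indicator hs) x)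
    (integrable_oscIntegrand a b c d e hψ hψc lam (hf.indicator hs.compl) x)]
  congr 1
  ext y
  rw [oscIntegrand, oscIntegrand, oscIntegrand, ← mul_add, Set.indicator_self_add_compl_apply]

/-- The interpolated bound for `1 < p < 2`, where `N` bounds `∫ |f|^p`. -/
lemma lintegral_enorm_oscOp_rpow_le (a b c d e : ℝ) {ψ : ℝ × ℝ → ℂ} (hψ : Continuous ψ)
    (hψc : HasCompactSupport ψ) {A lam : ℝ} {B : ℝ≥0∞} (hA0 : 0 < A) (hA : ∀ z, ‖ψ z‖ ≤ A)
    (hB : ∀ f : ℝ → ℂ, StronglyMeasurable f →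
      ∫⁻ x, ‖oscOp a b c d e ψ lam f x‖ₑ ^ 2 ≤ B * ∫⁻ y, ‖f y‖ₑ ^ 2)
    {p q N : ℝ} (hpq : p.HolderConjugate q) (hq : 2 < q) (hN : 0 < N)
    {f : ℝ → ℂ} (hfm : StronglyMeasurable f) (hf : LocallyIntegrable f)
    (hfN : ∫⁻ y, ‖f y‖ₑ ^ p ≤ ENNReal.ofReal N) :
    ∫⁻ x, ‖oscOp a b c d e ψ lam f x‖ₑ ^ q ≤
      ENNReal.ofReal (2 ^ q * A ^ (q - 2) * N ^ (q - 1)) * B := by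
  have conv : ∀ (g : ℝ → ℂ) (r : ℝ), 0 ≤ r → ∀ y, ‖g y‖ₑ ^ r = ENNReal.ofReal (‖g y‖ ^ r) :=
    fun g r hr y => by rw [← ofReal_norm, ENNReal.ofReal_rpow_of_nonneg (norm_nonneg _) hr]
  simp only [conv _ p hpq.nonneg] at hfN
  simp only [conv _ q hpq.symm.nonneg]
  refine lintegral_rpow_le_of_truncation hfm.norm.measurable
    (stronglyMeasurable_oscOp a b c d e hψ lam hfm).norm.measurable (fun _ => norm_nonneg _)
    (fun _ => norm_nonneg _) hpq hq hA0 hN hfN fun t _ => ?_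
  have hs : MeasurableSet {y | t < ‖f y‖} :=
    measurableSet_lt measurable_const hfm.norm.measurable
  have hsc : {y | t < ‖f y‖}ᶜ = {y | ‖f y‖ ≤ t} := by ext; simp
  refine ⟨fun x => ‖oscOp a b c d e ψ lam ({y | t < ‖f y‖}ᶜ.indicator f) x‖ₑ, fun x => ?_, ?_⟩
  · rw [ofReal_norm, oscOp_eq_add_indicator a b c d e hψ hψc lam hf hs x]
    refine (enorm_add_le _ _).trans (add_le_add_left ?_ _)
    refine (enorm_oscOp_le a b c d e hA lam _ x).trans_eq ?_
    simp only [enorm_indicator_eq_indicator_enorm, ofReal_norm]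
    rw [lintegral_indicator hs]
  · refine (hB _ (hfm.indicator hs.compl)).trans_eq ?_
    rw [← hsc, ← lintegral_indicator hs.compl]
    congr 2
    ext y
    by_cases hy : y ∈ {y | t < ‖f y‖}ᶜ
    · rw [Set.indicator_of_mem hy, Set.indicator_of_mem hy, ENNReal.ofReal_pow (norm_nonneg _),
        ofReal_norm]
    · rw [Set.indicator_of_notMem hy, Set.indicator_of_notMem hy]
      simp

/-- The bound of the theorem for a strongly measurable representative `f`, with `C₁ = 2 C`, where
`C` serves in both endpoint bounds. The factor `2` comes from the interpolation. -/
lemma eLpNorm_oscOp_le (a b c d e : ℝ) {ψ : ℝ × ℝ → ℂ} (hψ : Continuous ψ)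
    (hψc : HasCompactSupport ψ) {C lam : ℝ} (hC0 : 0 < C) (hlam : 0 < lam)
    (hC : ∀ z, ‖ψ z‖ ≤ C)
    (hB : ∀ f : ℝ → ℂ, StronglyMeasurable f →
      ∫⁻ x, ‖oscOp a b c d e ψ lam f x‖ₑ ^ 2 ≤ ENNReal.ofReal (C ^ 2 / lam) * ∫⁻ y, ‖f y‖ₑ ^ 2)
    {p p₁ : ℝ≥0∞} (hp2 : p ≤ 2) (hpp : p.HolderConjugate p₁)
    {f : ℝ → ℂ} (hfm : StronglyMeasurable f) (hf : MemLp f p) :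
    eLpNorm (oscOp a b c d e ψ lam f) p₁ volume ≤
      ENNReal.ofReal ((2 * C) ^ (2 / p.toReal - 1) *
        (2 * C / Real.sqrt lam) ^ (2 * (1 - 1 / p.toReal))) * eLpNorm f p volume := by
  have hp1 : 1 ≤ p := hpp.one_le
  have hptop : p ≠ ⊤ := ne_top_of_le_ne_top (by norm_num) hp2
  have hp0 : p ≠ 0 := (zero_lt_one.trans_le hp1).ne'
  have hinv := hpp.inv_add_inv_eq_one
  rcases hp1.eq_or_lt with rfl | hp1'
  · have h1 : p₁ = ⊤ := by simpa using hinv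
    subst h1
    rw [eLpNorm_exponent_top, eLpNorm_one_eq_lintegral_enorm]
    refine eLpNormEssSup_le_of_ae_enorm_bound (Filter.Eventually.of_forall fun x => ?_)
    refine (enorm_oscOp_le a b c d e (A := 2 * C) (fun z => (hC z).trans (by linarith))
      lam f x).trans_eq ?_
    norm_num
  have hp₁top : p₁ ≠ ⊤ := by
    rintro rfl
    simp at hinv
    exact hp1'.ne' hinv
  have hp₁1 : 1 ≤ p₁ := hpp.symm.one_le
  have hp₁0 : p₁ ≠ 0 := (zero_lt_one.trans_le hp₁1).ne'
  have hpr : p.toReal.HolderConjugate p₁.toReal := by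
    rw [Real.holderConjugate_iff]
    constructor
    · rw [← ENNReal.toReal_one]
      exact (ENNReal.toReal_lt_toReal (by norm_num) hptop).2 hp1'
    · rw [← ENNReal.toReal_inv, ← ENNReal.toReal_inv, ← ENNReal.toReal_add (by simpa using hp0)
        (by simpa using hp₁0), hinv, ENNReal.toReal_one]
  have hp2r : p.toReal ≤ 2 := by
    rw [← ENNReal.toReal_ofNat 2]
    exact ENNReal.toReal_mono (by norm_num) hp2
  rw [eLpNorm_eq_lintegral_rpow_enorm_toReal hp₁0 hp₁top,
    eLpNorm_eq_lintegral_rpow_enorm_toReal hp0 hptop]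
  have hfin : ∫⁻ y, ‖f y‖ₑ ^ p.toReal ≠ ⊤ :=
    ((eLpNorm_lt_top_iff_lintegral_rpow_enorm_lt_top hp0 hptop).1 hf.2).ne
  have hfl : LocallyIntegrable f := hf.locallyIntegrable hp1
  generalize p.toReal = r at *
  generalize p₁.toReal = q at *
  have hr1 : 1 < r := hpr.lt
  have hq0 : 0 < q := hpr.symm.pos
  have hmul := hpr.mul_eq_add
  have hexp : 2 * (1 - 1 / r) = 2 / q := by
    have := hpr.inv_add_inv_eq_one
    rw [one_div, div_eq_mul_inv 2 q]; linarith
  have hexp' : 2 / r - 1 = (q - 2) / q := by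
    rw [sub_div, div_self hq0.ne', ← hexp]; ring
  rw [hexp, hexp']
  obtain ⟨N, hN, hNe⟩ : ∃ N : ℝ, 0 ≤ N ∧ ∫⁻ y, ‖f y‖ₑ ^ r = ENNReal.ofReal N :=
    ⟨_, ENNReal.toReal_nonneg, (ENNReal.ofReal_toReal hfin).symm⟩
  -- the interpolation needs `N > 0`; for `N = 0` the function `f` vanishes almost everywhere
  rcases hN.eq_or_lt with hN0 | hN0
  · have hf0 : f =ᵐ[volume] 0 := by
      rw [← hN0, ENNReal.ofReal_zero, lintegral_eq_zero_iff
        (hfm.enorm.pow_const r)] at hNe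
      filter_upwards [hNe] with y hy
      simpa [ENNReal.rpow_eq_zero_iff, hr1.not_gt, (zero_lt_one.trans hr1)] using hy
    rw [oscOp_congr_ae a b c d e ψ lam hf0]
    have : oscOp a b c d e ψ lam 0 = 0 := by
      ext x; simp [oscOp, oscIntegrand]
    simp [this, hq0]
  have hmain : ∫⁻ x, ‖oscOp a b c d e ψ lam f x‖ₑ ^ q ≤
      ENNReal.ofReal (2 ^ q * C ^ (q - 2) * N ^ (q - 1) * (C ^ 2 / lam)) := by
    rcases hp2r.eq_or_lt with rfl | hr2
    -- at `p = 2` the weight `s ^ (q - 3)` is not integrable at `0`, but the `L²` bound applies directly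
    · have hq2 : q = 2 := by linarith
      subst hq2
      have := hB f hfm
      simp only [ENNReal.rpow_ofNat] at hNe ⊢
      rw [hNe, ← ENNReal.ofReal_mul (by positivity)] at this
      refine this.trans (ENNReal.ofReal_le_ofReal ?_)
      norm_num
      have : 0 ≤ N * (C ^ 2 / lam) := by positivity
      linarith
    · have hq2 : 2 < q := by
        by_contra hcon
        nlinarith [hpr.symm.lt]
      rw [ENNReal.ofReal_mul (by positivity)]
      exact lintegral_enorm_oscOp_rpow_le a b c d e hψ hψc hC0 hC hB hpr hq2 hN0 hfm hfl hNe.le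
  rw [hNe, ENNReal.ofReal_rpow_of_pos hN0, ← ENNReal.ofReal_mul (by positivity)]
  refine (ENNReal.rpow_le_rpow hmain (by positivity)).trans_eq ?_
  rw [ENNReal.ofReal_rpow_of_pos (by positivity)]
  congr 1
  have hNr : N ^ (1 / r) = (N ^ (q - 1)) ^ (1 / q) := by
    rw [← Real.rpow_mul hN0.le]
    congr 1
    have : 0 < r := by linarith
    field_simp
    linarith
  -- move both factors under the common exponent `1 / q`
  have hsq : (2 * C / Real.sqrt lam) ^ (2 / q) = ((2 * C) ^ 2 / lam) ^ (1 / q) := by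
    rw [show 2 / q = (2 : ℝ) * (1 / q) by ring, Real.rpow_mul (by positivity), Real.rpow_two,
      div_pow, Real.sq_sqrt hlam.le]
  have hC2 : (2 * C) ^ ((q - 2) / q) = ((2 * C) ^ (q - 2)) ^ (1 / q) := by
    rw [← Real.rpow_mul (by positivity)]
    congr 1; ring
  rw [hNr, hsq, hC2, ← Real.mul_rpow (by positivity) (by positivity),
    ← Real.mul_rpow (by positivity) (by positivity)]
  congr 1
  have h2 : (2 : ℝ) ^ q = 2 ^ (q - 2) * 2 ^ 2 := by
    rw [← Real.rpow_two, ← Real.rpow_add (by norm_num)]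
    congr 1; ring
  rw [Real.mul_rpow (by norm_num) hC0.le, h2]
  ring

theorem theorem2p1 (a b c d e : ℝ) (hb : b ≠ 0)
    (ψ : ℝ × ℝ → ℂ) (hψ : ContDiff ℝ ∞ ψ) (hψc : HasCompactSupport ψ) :
    ∃ C₁ : ℝ, 0 < C₁ ∧ (∀ x y : ℝ, ‖ψ (x, y)‖ ≤ C₁) ∧
      ∀ lam : ℝ, 0 < lam →
      ∀ p p₁ : ℝ≥0∞, 1 ≤ p → p ≤ 2 → p.HolderConjugate p₁ →
      ∀ f : ℝ → ℂ, MemLp f p volume →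
        (∀ x : ℝ, Integrable (oscIntegrand a b c d e ψ lam f x) volume) ∧
        MemLp (oscOp a b c d e ψ lam f) p₁ volume ∧
        eLpNorm (oscOp a b c d e ψ lam f) p₁ volume ≤
          ENNReal.ofReal (C₁ ^ (2 / p.toReal - 1) *
            (C₁ / Real.sqrt lam) ^ (2 * (1 - 1 / p.toReal))) * eLpNorm f p volume := by
  obtain ⟨-, A, -, hA0, hA, -⟩ :=
    exists_bound_of_continuous_of_hasCompactSupport hψ.continuous hψc
  obtain ⟨B, hB0, hB⟩ := exists_lintegral_enorm_oscOp_sq_le a b c d e hb hψ hψc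
  refine ⟨2 * (A + B), by positivity, fun x y => (hA _).trans (by linarith),
    fun lam hlam p p₁ hp1 hp2 hpp f hf => ?_⟩
  set f' : ℝ → ℂ := hf.1.mk f with hf'
  have hff' : f =ᵐ[volume] f' := hf.1.ae_eq_mk
  have hfm : StronglyMeasurable f' := hf.1.stronglyMeasurable_mk
  have hbound := eLpNorm_oscOp_le a b c d e hψ.continuous hψc (C := A + B) (by positivity) hlam
    (fun z => (hA z).trans (by linarith))
    (fun g hg => (hB lam hlam g hg).trans (by gcongr; linarith)) hp2 hpp hfm
    ((memLp_congr_ae hff').1 hf)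
  rw [← oscOp_congr_ae a b c d e ψ lam hff', ← eLpNorm_congr_ae hff'] at hbound
  refine ⟨integrable_oscIntegrand a b c d e hψ.continuous hψc lam (hf.locallyIntegrable hp1),
    ⟨?_, hbound.trans_lt (ENNReal.mul_lt_top ENNReal.ofReal_lt_top hf.2)⟩, hbound⟩
  rw [oscOp_congr_ae a b c d e ψ lam hff']
  exact (stronglyMeasurable_oscOp a b c d e hψ.continuous lam hfm).aestronglyMeasurable
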